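/- Let $N,d,k\ge 1$ be integers, $T>0$, $0<\beta<1$, and put $b(z)=(1-e^{-z})^{-1}$, so that $b(M)=(I-e^{-M})^{-1}$ for a square matrix $M$. Let $A_h\in\mathbb R^{N^d\times N^d}$ be symmetric and positive definite with smallest eigenvalue $\lambda_1$, and let $\rho$ be such that all eigenvalues of $TA_h$ lie in $[0,\rho]$ (for instance the spectral radius of $TA_h$). Let $g\in\mathbb R^{N^d}$, $g\neq 0$, and let $Q\in\mathbb R^{N^d\times k}$ and $H=Q^*A_hQ\in\mathbb R^{k\times k}$ be the matrices produced by $k$ steps, without breakdown, of the Arnoldi procedure applied to $A_h$ with starting vector $g$; that is, the columns $q_1,\dots,q_k$ of $Q$ are given by $q_1=g/\|g\|$ and, for $1\le j<k$, $q_{j+1}=w_j/\|w_j\|$ with $w_j=A_hq_j-\sum_{i=1}^{j}\langle q_i,A_hq_j\rangle q_i\ne 0$. Let $\mu_1$ be the smallest eigenvalue of $H$, let $m=\lfloor k^\beta\rfloor$, and let $C=\|Q\|\,\|Q^*\|$, where $\|\cdot\|$ is the Euclidean norm of vectors and the operator norm it induces on matrices. Then $\mu_1>0$, the matrices $I-e^{-TA_h}$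 and $I-e^{-TH}$ are invertible, and $$\big\|b(TA_h)g-Q\,b(TH)\,Q^*g\big\|\le\left(\frac{N^d e^{-T\lambda_1 m}}{(1-e^{-T\lambda_1})^{m+1}}+\frac{C\,k\,e^{-T\mu_1 m}}{(1-e^{-T\mu_1})^{m+1}}+10(m-1)e^{-\frac{4k^{2-\beta}}{5\rho}}\right)\|g\|.$$ -/

import Mathlib

noncomputable section

/-- The linear map between Euclidean spaces given by a real matrix. -/
def euclMap {p q : ℕ} (M : Matrix (Fin p) (Fin q) ℝ) :
    EuclideanSpace ℝ (Fin q) →L[ℝ] EuclideanSpace ℝ (Fin p) :=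
  LinearMap.toContinuousLinearMap (Matrix.toEuclideanLin M)

/-- The `j`-th column of a matrix, as a vector of Euclidean space. -/
def euclCol {p q : ℕ} (M : Matrix (Fin p) (Fin q) ℝ) (j : Fin q) : EuclideanSpace ℝ (Fin p) :=
  WithLp.toLp 2 (fun i => M i j)

/-- The matrix function `b(M) = (I - e^{-M})⁻¹`, for `b(z) = (1 - e^{-z})⁻¹`. -/
def matB {p : ℕ} (M : Matrix (Fin p) (Fin p) ℝ) : Matrix (Fin p) (Fin p) ℝ :=
  (1 - NormedSpace.exp (-M))⁻¹

/-- The vector left over in step `j` of the Arnoldi procedure, when `A q_j` is orthogonalised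
against the basis vectors `q_i`, `i ≤ j`, found so far (the columns of `Q`):
`w_j = A q_j - ∑_{i ≤ j} ⟨q_i, A q_j⟩ q_i`. -/
def arnoldiResidual {n k : ℕ} (A : Matrix (Fin n) (Fin n) ℝ) (Q : Matrix (Fin n) (Fin k) ℝ)
    (j : Fin k) : EuclideanSpace ℝ (Fin n) :=
  euclMap A (euclCol Q j) -
    ∑ i ∈ Finset.Iic j, (inner ℝ (euclCol Q i) (euclMap A (euclCol Q j))) • euclCol Q i

/-- `Q` and `H` are the matrices produced by `k` steps of the Arnoldi procedure (without breakdown)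
applied to the matrix `A` with starting vector `g`: the first column of `Q` is `g / ‖g‖`, each
further column is the normalised residual `w_j / ‖w_j‖` of the step before (with `w_j ≠ 0`), and
`H = Q* A Q`. -/
structure IsArnoldi {n k : ℕ} (A : Matrix (Fin n) (Fin n) ℝ) (g : EuclideanSpace ℝ (Fin n))
    (Q : Matrix (Fin n) (Fin k) ℝ) (H : Matrix (Fin k) (Fin k) ℝ) : Prop where
  start_ne_zero : g ≠ 0
  first_col : ∀ j : Fin k, (j : ℕ) = 0 → euclCol Q j = ‖g‖⁻¹ • g
  no_breakdown : ∀ i j : Fin k, (j : ℕ) = i + 1 → arnoldiResidual A Q i ≠ 0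
  next_col : ∀ i j : Fin k, (j : ℕ) = i + 1 →
    euclCol Q j = ‖arnoldiResidual A Q i‖⁻¹ • arnoldiResidual A Q i
  compression : H = Q.transpose * A * Q

end

/-!
Let `q = e^{-A}` for the symmetric positive definite operator `A` (`T` times the matrix of the
theorem), let `a > 0` be a lower bound and `ρ` an upper bound of its spectrum, and let `Q† A Q` be
the Arnoldi compression. Since `‖q‖ ≤ e^{-a} < 1`, the Neumann series gives `b(A) = ∑ e^{-lA}`
with a remainder after `m` terms of norm at most `e^{-am} / (1 - e^{-a})`; likewise for the
compression (`norm_inverse_sub_compressed_inverse_le`). It remains to compare `e^{-lA} g` with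
`Q e^{-l Q† A Q} Q† g` for `l < m`, and these agree for `l = 0`.

The projection error `p(A) g - Q p(Q† A Q) Q† g` is linear in `p`, vanishes for polynomials of
degree below `k` (`IsKrylovFlag.galerkinError_eq_zero`) and is at most `2 ‖g‖` times the maximum
of `|p|` on an interval containing the spectrum (`norm_galerkinError_le`). Take that interval to
be `[-1, 1]`. Because `2 X T_i = T_{i+1} + T_{i-1}`, the monomial `X ^ n` is the average of the
Chebyshev polynomials `T_i` over the endpoints `i` of a simple random walk with `n` steps, and
only endpoints with `|i| ≥ k` contribute to the error; Chernoff's bound for the walk then reads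
`‖error (X ^ n)‖ ≤ 4 e^{-kθ} (cosh θ)^n ‖g‖` for every `θ ≥ 0`
(`norm_galerkinError_X_pow_mul_T_le`). Summing the exponential series and rescaling the interval
yields a bound for `e^{-lA}` with `θ` still free (`norm_exp_neg_smul_sub_le`).

Put `y = ρ k^β`, so that `ρ l ≤ ρ m ≤ y`. If `y ≥ k`, then `θ = 8k / (5y)` gives the bound
`4 e^{-4k² / (5y)} ‖g‖`, which goes into the last term of the claim. If `y ≤ k`, that bound need not
hold, but `θ = log 5` and the lower end `a / 2` of the interval give at most `e^{-am} ‖g‖`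
provided `k ≥ 3`, which `m ≥ 2` forces (`norm_exp_neg_smul_sub_le_add`). There are `m - 1` such terms
and `m ≤ k ≤ N ^ d`, so they are absorbed by the factor `N ^ d` of the first term of the claim, of
which the Neumann remainder uses only one copy.
-/

open Polynomial ContinuousLinearMap

section Operators

/-! ### Functions of symmetric operators -/

variable {E F : Type*} [NormedAddCommGroup E] [InnerProductSpace ℝ E]
  [NormedAddCommGroup F] [InnerProductSpace ℝ F]

/-- An operator that acts on each eigenvector of a symmetric operator as a scalar of absolute value
at most `K` has norm at most `K`, since it is diagonal in an orthonormal eigenbasis. -/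
lemma norm_le_of_forall_eigenvector [FiniteDimensional ℝ E] {A S : E →L[ℝ] E}
    (hA : (A : E →ₗ[ℝ] E).IsSymmetric) {K : ℝ} (hK : 0 ≤ K)
    (h : ∀ (t : ℝ) (v : E), v ≠ 0 → A v = t • v → ∃ c : ℝ, |c| ≤ K ∧ S v = c • v) : ‖S‖ ≤ K := by
  set b := hA.eigenvectorBasis rfl with hb
  have key : ∀ i, ∃ c : ℝ, |c| ≤ K ∧ S (b i) = c • b i := by
    intro i
    refine h (hA.eigenvalues rfl i) (b i) (b.orthonormal.ne_zero i) ?_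
    exact hA.apply_eigenvectorBasis rfl i
  choose c hc hS using key
  refine S.opNorm_le_bound hK fun x => ?_
  have hx : S x = ∑ i, (c i * b.repr x i) • b i := by
    conv_lhs => rw [← b.sum_repr x]
    simp only [map_sum, map_smul, hS, smul_smul]
    exact Finset.sum_congr rfl fun i _ => by rw [mul_comm]
  have hr : ∀ i, b.repr (S x) i = c i * b.repr x i := by
    intro i
    rw [hx, b.repr_apply_apply]
    exact b.orthonormal.inner_right_fintype _ i
  rw [← b.repr.norm_map (S x), ← b.repr.norm_map x]
  refine (sq_le_sq₀ (by positivity) (by positivity)).mp ?_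
  rw [mul_pow, EuclideanSpace.norm_sq_eq, EuclideanSpace.norm_sq_eq, Finset.mul_sum]
  refine Finset.sum_le_sum fun i _ => ?_
  rw [hr, norm_mul, mul_pow]
  gcongr
  exact hc i

lemma aeval_apply_of_apply_eq_smul {A : E →L[ℝ] E} {t : ℝ} {v : E} (h : A v = t • v) (p : ℝ[X]) :
    aeval A p v = p.eval t • v := by
  induction p using Polynomial.induction_on' with
  | add p q hp hq => simp [hp, hq, add_smul]
  | monomial n a =>
    have : ∀ n : ℕ, (A ^ n) v = t ^ n • v := by
      intro n
      induction n with
      | zero => simp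
      | succ n ih =>
        rw [pow_succ, show (A ^ n * A) v = (A ^ n) (A v) from rfl, h, map_smul, ih, smul_smul,
          pow_succ, mul_comm]
    rw [aeval_monomial, ← Algebra.smul_def, smul_apply, this, eval_monomial, mul_smul]

lemma exp_apply_of_apply_eq_smul [CompleteSpace E] {A : E →L[ℝ] E} {t : ℝ} {v : E}
    (h : A v = t • v) : NormedSpace.exp A v = Real.exp t • v := by
  have h1 := (NormedSpace.exp_series_hasSum_exp' (𝕂 := ℝ) A).mapL
    (ContinuousLinearMap.apply ℝ E v)
  have h2 := (NormedSpace.exp_series_hasSum_exp' (𝕂 := ℝ) t).smul_const v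
  rw [← Real.exp_eq_exp_ℝ] at h2
  refine h1.unique (h2.congr_fun ?_)
  intro n
  have := aeval_apply_of_apply_eq_smul h (X ^ n : ℝ[X])
  simp at this
  simp [this, smul_smul]

/-- The quadratic form of `A` lies between `a` and `b` times the squared norm. -/
def FormBounds (A : E →L[ℝ] E) (a b : ℝ) : Prop :=
  ∀ v : E, a * ‖v‖ ^ 2 ≤ inner ℝ (A v) v ∧ inner ℝ (A v) v ≤ b * ‖v‖ ^ 2

lemma FormBounds.eigenvalue_mem {A : E →L[ℝ] E} {a b t : ℝ} (h : FormBounds A a b) {v : E}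
    (hv : v ≠ 0) (hAv : A v = t • v) : a ≤ t ∧ t ≤ b := by
  have := h v
  rw [hAv, real_inner_smul_left, real_inner_self_eq_norm_sq] at this
  have hp : 0 < ‖v‖ ^ 2 := by positivity
  exact ⟨le_of_mul_le_mul_right this.1 hp, le_of_mul_le_mul_right this.2 hp⟩

lemma FormBounds.le {A : E →L[ℝ] E} {a b : ℝ} (h : FormBounds A a b) {g : E} (hg : g ≠ 0) :
    a ≤ b :=
  le_of_mul_le_mul_right ((h g).1.trans (h g).2) (by positivity)

lemma FormBounds.mono_left {A : E →L[ℝ] E} {a a' b : ℝ} (h : FormBounds A a b) (ha : a' ≤ a) :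
    FormBounds A a' b :=
  fun v => ⟨(mul_le_mul_of_nonneg_right ha (sq_nonneg _)).trans (h v).1, (h v).2⟩

lemma norm_aeval_le [FiniteDimensional ℝ E] {A : E →L[ℝ] E} (hA : (A : E →ₗ[ℝ] E).IsSymmetric)
    {a b : ℝ} (hab : FormBounds A a b) {p : ℝ[X]} {K : ℝ} (hK : 0 ≤ K)
    (hp : ∀ t, a ≤ t → t ≤ b → |p.eval t| ≤ K) : ‖aeval A p‖ ≤ K :=
  norm_le_of_forall_eigenvector hA hK fun t _ hv hAv =>
    ⟨p.eval t, hp t (hab.eigenvalue_mem hv hAv).1 (hab.eigenvalue_mem hv hAv).2,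
      aeval_apply_of_apply_eq_smul hAv p⟩

lemma norm_exp_neg_le [FiniteDimensional ℝ E] {A : E →L[ℝ] E}
    (hA : (A : E →ₗ[ℝ] E).IsSymmetric) {a b : ℝ} (hab : FormBounds A a b) :
    ‖NormedSpace.exp (-A)‖ ≤ Real.exp (-a) := by
  have := FiniteDimensional.complete ℝ E
  refine norm_le_of_forall_eigenvector hA (Real.exp_nonneg _) fun t v hv hAv =>
    ⟨Real.exp (-t), ?_, exp_apply_of_apply_eq_smul (by simp [hAv])⟩
  rw [abs_of_nonneg (Real.exp_nonneg _)]
  exact Real.exp_le_exp.mpr (neg_le_neg (hab.eigenvalue_mem hv hAv).1)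

lemma exp_smul_one_add [CompleteSpace E] (c : ℝ) (M : E →L[ℝ] E) :
    NormedSpace.exp (c • (1 : E →L[ℝ] E) + M) = Real.exp c • NormedSpace.exp M := by
  let _ : NormedAlgebra ℚ (E →L[ℝ] E) := NormedAlgebra.restrictScalars ℚ ℝ (E →L[ℝ] E)
  rw [NormedSpace.exp_add_of_commute ((Commute.one_left M).smul_left c),
    ← Algebra.algebraMap_eq_smul_one, ← NormedSpace.algebraMap_exp_comm, ← Real.exp_eq_exp_ℝ,
    ← Algebra.smul_def]

lemma exp_neg_smul_eq_smul_exp [CompleteSpace E] (M : E →L[ℝ] E) {τ r σ c d : ℝ}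
    (h1 : r + σ * c = 0) (h2 : σ * d = -τ) :
    NormedSpace.exp (-(τ • M)) =
      Real.exp r • NormedSpace.exp (σ • (c • (1 : E →L[ℝ] E) + d • M)) := by
  rw [← exp_smul_one_add, smul_add, ← add_assoc, smul_smul, smul_smul, ← add_smul, h1, h2]
  simp

lemma exp_neg_pow [CompleteSpace E] (M : E →L[ℝ] E) (l : ℕ) :
    NormedSpace.exp (-M) ^ l = NormedSpace.exp (-((l : ℝ) • M)) := by
  let _ : NormedAlgebra ℚ (E →L[ℝ] E) := NormedAlgebra.restrictScalars ℚ ℝ (E →L[ℝ] E)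
  rw [← NormedSpace.exp_nsmul, ← smul_neg, Nat.cast_smul_eq_nsmul]

/-! ### The projection error of polynomials -/

/-- The operator `A` moves the flag `V` up by one step at most, the flag starts at `g` and its
first `k` members lie in the range of `Q`; thus `A ^ j g` is in the range of `Q` for `j < k`. -/
structure IsKrylovFlag (A : E →L[ℝ] E) (Q : F →L[ℝ] E) (g : E) (k : ℕ)
    (V : ℕ → Submodule ℝ E) : Prop where
  mono : Monotone V
  start : g ∈ V 0
  map : ∀ j, j + 1 < k → ∀ v ∈ V j, A v ∈ V (j + 1)
  le_range : ∀ j, j < k → ∀ v ∈ V j, ∃ x, Q x = v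

/-- A flag for `A` also serves every affine function of `A`. -/
lemma IsKrylovFlag.affine {A : E →L[ℝ] E} {Q : F →L[ℝ] E} {g : E} {k : ℕ}
    {V : ℕ → Submodule ℝ E} (h : IsKrylovFlag A Q g k V) (c d : ℝ) :
    IsKrylovFlag (c • 1 + d • A) Q g k V where
  mono := h.mono
  start := h.start
  map := fun j hj v hv => by
    simpa using (V (j + 1)).add_mem ((V (j + 1)).smul_mem c (h.mono j.le_succ hv))
      ((V (j + 1)).smul_mem d (h.map j hj v hv))
  le_range := h.le_range

variable [CompleteSpace E] [CompleteSpace F]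

/-- The compression `Q† A Q` of an operator `A` along `Q`. -/
noncomputable def operatorCompression (Q : F →L[ℝ] E) (A : E →L[ℝ] E) : F →L[ℝ] F :=
  adjoint Q ∘L A ∘L Q

/-- The error `p(A) g - Q p(Q† A Q) Q† g` of the projection method for the polynomial `p`. -/
noncomputable def galerkinError (Q : F →L[ℝ] E) (A : E →L[ℝ] E) (g : E) (p : ℝ[X]) : E :=
  aeval A p g - Q (aeval (operatorCompression Q A) p (adjoint Q g))

lemma galerkinError_add (Q : F →L[ℝ] E) (A : E →L[ℝ] E) (g : E) (p q : ℝ[X]) :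
    galerkinError Q A g (p + q) = galerkinError Q A g p + galerkinError Q A g q := by
  simp only [galerkinError, map_add, add_apply]; abel

lemma galerkinError_smul (Q : F →L[ℝ] E) (A : E →L[ℝ] E) (g : E) (c : ℝ) (p : ℝ[X]) :
    galerkinError Q A g (c • p) = c • galerkinError Q A g p := by
  simp only [galerkinError, map_smul, smul_apply, smul_sub]

/-- The projection method is exact for polynomials of degree less than `k`: by induction on `j < k`,
`A ^ j g` lies in the range of `Q`, which `Q Q†` fixes, and equals `Q (Q† A Q) ^ j Q† g`. -/
lemma IsKrylovFlag.galerkinError_eq_zero {A : E →L[ℝ] E} {Q : F →L[ℝ] E} {g : E} {k : ℕ}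
    {V : ℕ → Submodule ℝ E} (h : IsKrylovFlag A Q g k V) (hQ : adjoint Q ∘L Q = 1)
    {p : ℝ[X]} (hp : p.natDegree < k) : galerkinError Q A g p = 0 := by
  have hproj : ∀ j, j < k → ∀ v ∈ V j, Q (adjoint Q v) = v := by
    intro j hj v hv
    obtain ⟨x, rfl⟩ := h.le_range j hj v hv
    have : adjoint Q (Q x) = x := congr($hQ x)
    rw [this]
  have hpow : ∀ j, j < k → (A ^ j) g ∈ V j ∧
      Q ((operatorCompression Q A ^ j) (adjoint Q g)) = (A ^ j) g := by
    intro j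
    induction j with
    | zero => intro hk; exact ⟨by simpa using h.start, by simpa using hproj 0 hk g h.start⟩
    | succ j ih =>
      intro hj
      obtain ⟨hm, he⟩ := ih (by omega)
      have hm' : (A ^ (j + 1)) g ∈ V (j + 1) := by
        rw [pow_succ']; exact h.map j hj _ hm
      refine ⟨hm', ?_⟩
      rw [pow_succ', pow_succ' A]
      change Q (adjoint Q (A (Q ((operatorCompression Q A ^ j) (adjoint Q g))))) = A ((A ^ j) g)
      rw [pow_succ'] at hm'
      rw [he]
      exact hproj _ hj _ hm'
  rw [galerkinError, sub_eq_zero, aeval_eq_sum_range, aeval_eq_sum_range]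
  simp only [sum_apply, smul_apply, map_sum, map_smul]
  refine Finset.sum_congr rfl fun j hj => ?_
  rw [(hpow j (by simp at hj; omega)).2]

lemma norm_map_of_adjoint_comp_self {Q : F →L[ℝ] E} (hQ : adjoint Q ∘L Q = 1) (x : F) :
    ‖Q x‖ = ‖x‖ := by
  have h : adjoint Q (Q x) = x := congr($hQ x)
  refine (sq_eq_sq₀ (norm_nonneg _) (norm_nonneg _)).mp ?_
  rw [← real_inner_self_eq_norm_sq, ← real_inner_self_eq_norm_sq, ← adjoint_inner_left, h]

lemma norm_adjoint_apply_le {Q : F →L[ℝ] E} (hQ : adjoint Q ∘L Q = 1) (x : E) :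
    ‖adjoint Q x‖ ≤ ‖x‖ := by
  have h1 : ‖adjoint Q‖ ≤ 1 := by
    rw [LinearIsometryEquiv.norm_map]
    exact Q.opNorm_le_bound zero_le_one fun y => by simp [norm_map_of_adjoint_comp_self hQ]
  simpa using (adjoint Q).le_of_opNorm_le h1 x

lemma isSymmetric_operatorCompression {A : E →L[ℝ] E} (hA : (A : E →ₗ[ℝ] E).IsSymmetric)
    (Q : F →L[ℝ] E) : (operatorCompression Q A : F →ₗ[ℝ] F).IsSymmetric := by
  intro x y
  change inner ℝ (adjoint Q (A (Q x))) y = inner ℝ x (adjoint Q (A (Q y)))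
  rw [adjoint_inner_left, adjoint_inner_right]
  exact hA _ _

lemma FormBounds.compress {A : E →L[ℝ] E} {a b : ℝ} (h : FormBounds A a b)
    {Q : F →L[ℝ] E} (hQ : adjoint Q ∘L Q = 1) : FormBounds (operatorCompression Q A) a b := by
  intro v
  change _ ≤ inner ℝ (adjoint Q (A (Q v))) v ∧ inner ℝ (adjoint Q (A (Q v))) v ≤ _
  rw [adjoint_inner_left, ← norm_map_of_adjoint_comp_self hQ v]
  exact h _

lemma norm_galerkinError_le [FiniteDimensional ℝ E] [FiniteDimensional ℝ F]
    {A : E →L[ℝ] E} (hA : (A : E →ₗ[ℝ] E).IsSymmetric)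
    {a b : ℝ} (hab : FormBounds A a b) {Q : F →L[ℝ] E} (hQ : adjoint Q ∘L Q = 1) (g : E)
    {p : ℝ[X]} {K : ℝ} (hK : 0 ≤ K) (hp : ∀ t, a ≤ t → t ≤ b → |p.eval t| ≤ K) :
    ‖galerkinError Q A g p‖ ≤ 2 * K * ‖g‖ := by
  have h1 := (aeval A p).le_of_opNorm_le (norm_aeval_le hA hab hK hp) g
  have h2 := (aeval (operatorCompression Q A) p).le_of_opNorm_le
    (norm_aeval_le (isSymmetric_operatorCompression hA Q) (hab.compress hQ) hK hp) (adjoint Q g)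
  rw [← norm_map_of_adjoint_comp_self hQ] at h2
  have h3 := mul_le_mul_of_nonneg_left (norm_adjoint_apply_le hQ g) hK
  calc _ ≤ _ := norm_sub_le _ _
    _ ≤ _ := by linarith

/-! ### Chebyshev bounds for the projection error of exponentials -/

/-- Chernoff's bound for the random walk behind `2 X T_i = T_{i+1} + T_{i-1}`, started at `i`. The
induction on `n` closes because `cosh ((i+1)θ) + cosh ((i-1)θ) = 2 cosh θ cosh (iθ)`. -/
lemma norm_galerkinError_X_pow_mul_T_le [FiniteDimensional ℝ E] [FiniteDimensional ℝ F]
    {B : E →L[ℝ] E} (hB : (B : E →ₗ[ℝ] E).IsSymmetric)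
    (hab : FormBounds B (-1) 1) {Q : F →L[ℝ] E} (hQ : adjoint Q ∘L Q = 1) {g : E} {k : ℕ}
    {V : ℕ → Submodule ℝ E} (hV : IsKrylovFlag B Q g k V) {θ : ℝ} (hθ : 0 ≤ θ) (n : ℕ) (i : ℤ) :
    ‖galerkinError Q B g (X ^ n * Chebyshev.T ℝ i)‖ ≤
      4 * Real.cosh (i * θ) * Real.exp (-(k * θ)) * Real.cosh θ ^ n * ‖g‖ := by
  induction n generalizing i with
  | zero =>
    rw [pow_zero, one_mul, pow_zero, mul_one]
    by_cases hi : i.natAbs < k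
    · rw [hV.galerkinError_eq_zero hQ (by rwa [Chebyshev.natDegree_T]), norm_zero]
      have := Real.cosh_pos (i * θ)
      positivity
    · -- the error is at most twice the maximum of `|T_i|`, and `1 ≤ 2 cosh (iθ) e^{-kθ}`
      have h1 : ‖galerkinError Q B g (Chebyshev.T ℝ i)‖ ≤ 2 * 1 * ‖g‖ :=
        norm_galerkinError_le hB hab hQ g zero_le_one fun t h1 h2 =>
          Chebyshev.abs_eval_T_real_le_one i (abs_le.mpr ⟨h1, h2⟩)
      refine h1.trans (mul_le_mul_of_nonneg_right ?_ (norm_nonneg g))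
      have h2 : Real.exp (k * θ) ≤ 2 * Real.cosh (i * θ) := by
        rw [← Real.cosh_abs, abs_mul, abs_of_nonneg hθ, Real.cosh_eq]
        have h3 : (k : ℝ) ≤ |(i : ℝ)| := by
          rw [← Int.cast_abs, Int.abs_eq_natAbs, ← Int.cast_natCast k]
          exact Int.cast_le.mpr (Int.ofNat_le.mpr (not_lt.mp hi))
        have h4 : Real.exp (k * θ) ≤ Real.exp (|(i : ℝ)| * θ) :=
          Real.exp_le_exp.mpr (mul_le_mul_of_nonneg_right h3 hθ)
        have := Real.exp_pos (-(|(i : ℝ)| * θ))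
        linarith
      have h5 : Real.exp (k * θ) * Real.exp (-(k * θ)) = 1 := by
        rw [← Real.exp_add]; simp
      nlinarith [Real.exp_pos (-(k * θ))]
  | succ n ih =>
    have hrec : (X ^ (n + 1) * Chebyshev.T ℝ i : ℝ[X]) =
        (1 / 2 : ℝ) • (X ^ n * Chebyshev.T ℝ (i + 1) + X ^ n * Chebyshev.T ℝ (i - 1)) := by
      have h := Chebyshev.T_eq ℝ (i + 1)
      rw [show i + 1 - 1 = i by ring, show i + 1 - 2 = i - 1 by ring] at h
      rw [h, smul_eq_C_mul]
      have : (C (1 / 2 : ℝ)) * 2 = 1 := by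
        rw [show (2 : ℝ[X]) = C 2 from rfl, ← C_mul]; norm_num
      linear_combination (-(X ^ (n + 1) * Chebyshev.T ℝ i)) * this
    rw [hrec, galerkinError_smul, galerkinError_add, norm_smul]
    have hc : Real.cosh ((i + 1 : ℤ) * θ) + Real.cosh ((i - 1 : ℤ) * θ) =
        2 * Real.cosh θ * Real.cosh (i * θ) := by
      push_cast
      rw [add_mul, sub_mul, one_mul, Real.cosh_add, Real.cosh_sub]; ring
    have h1 := ih (i + 1)
    have h2 := ih (i - 1)
    have h3 := norm_add_le (galerkinError Q B g (X ^ n * Chebyshev.T ℝ (i + 1)))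
      (galerkinError Q B g (X ^ n * Chebyshev.T ℝ (i - 1)))
    have h4 : 4 * Real.cosh (i * θ) * Real.exp (-(k * θ)) * Real.cosh θ ^ (n + 1) * ‖g‖ =
      (1 / 2) * (4 * Real.cosh ((i + 1 : ℤ) * θ) * Real.exp (-(k * θ)) * Real.cosh θ ^ n * ‖g‖ +
        4 * Real.cosh ((i - 1 : ℤ) * θ) * Real.exp (-(k * θ)) * Real.cosh θ ^ n * ‖g‖) := by
      rw [pow_succ]
      linear_combination (-2 * Real.exp (-(k * θ)) * Real.cosh θ ^ n * ‖g‖) * hc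
    rw [h4, Real.norm_of_nonneg (by norm_num)]
    linarith

variable [FiniteDimensional ℝ E] [FiniteDimensional ℝ F]

/-- The bounds for the monomials, summed over the exponential series. -/
lemma norm_exp_smul_sub_le {B : E →L[ℝ] E} (hB : (B : E →ₗ[ℝ] E).IsSymmetric)
    (hab : FormBounds B (-1) 1) {Q : F →L[ℝ] E} (hQ : adjoint Q ∘L Q = 1) {g : E} {k : ℕ}
    {V : ℕ → Submodule ℝ E} (hV : IsKrylovFlag B Q g k V) {θ τ : ℝ} (hθ : 0 ≤ θ) (hτ : 0 ≤ τ) :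
    ‖NormedSpace.exp (τ • B) g - Q (NormedSpace.exp (τ • operatorCompression Q B) (adjoint Q g))‖ ≤
      4 * Real.exp (-(k * θ)) * Real.exp (τ * Real.cosh θ) * ‖g‖ := by
  have h1 := (NormedSpace.exp_series_hasSum_exp' (𝕂 := ℝ) (τ • B)).mapL
    (ContinuousLinearMap.apply ℝ E g)
  have h2 := ((NormedSpace.exp_series_hasSum_exp' (𝕂 := ℝ) (τ • operatorCompression Q B)).mapL
    (ContinuousLinearMap.apply ℝ F (adjoint Q g))).mapL Q
  have h3 := NormedSpace.exp_series_hasSum_exp' (𝕂 := ℝ) (τ * Real.cosh θ)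
  rw [← Real.exp_eq_exp_ℝ] at h3
  have h4 := h3.mul_left (4 * Real.exp (-(k * θ)) * ‖g‖)
  refine ((h1.sub h2).norm_le_of_bounded h4 fun n => ?_).trans_eq (by ring)
  have h5 : galerkinError Q B g (X ^ n) =
      (B ^ n) g - Q ((operatorCompression Q B ^ n) (adjoint Q g)) := by
    simp [galerkinError]
  have h6 := norm_galerkinError_X_pow_mul_T_le hB hab hQ hV hθ n 0
  rw [Chebyshev.T_zero, mul_one, Int.cast_zero, zero_mul, Real.cosh_zero, mul_one] at h6
  have h7 : ((n.factorial : ℝ)⁻¹ * τ ^ n) • galerkinError Q B g (X ^ n) =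
      ContinuousLinearMap.apply ℝ E g ((n.factorial : ℝ)⁻¹ • (τ • B) ^ n) -
      Q (ContinuousLinearMap.apply ℝ F (adjoint Q g)
        ((n.factorial : ℝ)⁻¹ • (τ • operatorCompression Q B) ^ n)) := by
    simp only [h5, _root_.smul_pow, apply_apply, map_smul, smul_sub, smul_smul]
  rw [← h7, norm_smul, Real.norm_of_nonneg (by positivity), smul_eq_mul, mul_pow]
  calc _ ≤ ((n.factorial : ℝ)⁻¹ * τ ^ n) *
        (4 * Real.exp (-(k * θ)) * Real.cosh θ ^ n * ‖g‖) := by gcongr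
    _ = _ := by ring

/-- The error for `e^{-τA}` when the spectrum of `A` lies in `[a, b]`; this interval is mapped to
`[-1, 1]`. -/
lemma norm_exp_neg_smul_sub_le {A : E →L[ℝ] E} (hA : (A : E →ₗ[ℝ] E).IsSymmetric) {a b : ℝ}
    (hlt : a < b) (hab : FormBounds A a b) {Q : F →L[ℝ] E} (hQ : adjoint Q ∘L Q = 1) {g : E}
    {k : ℕ} {V : ℕ → Submodule ℝ E} (hV : IsKrylovFlag A Q g k V) {θ τ : ℝ} (hθ : 0 ≤ θ)
    (hτ : 0 ≤ τ) :
    ‖NormedSpace.exp (-(τ • A)) g -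
        Q (NormedSpace.exp (-(τ • operatorCompression Q A)) (adjoint Q g))‖ ≤
      4 * Real.exp (-(τ * a) + τ * (b - a) * ((Real.cosh θ - 1) / 2) - k * θ) * ‖g‖ := by
  have hd : 0 < b - a := sub_pos.mpr hlt
  have hd' := hd.ne'
  -- `t ↦ c + d t` maps `[a, b]` onto `[-1, 1]`, reversing the orientation
  set c := (b + a) / (b - a) with hc
  set d := -(2 / (b - a)) with hd2
  set B : E →L[ℝ] E := c • 1 + d • A with hBdef
  have hB : (B : E →ₗ[ℝ] E).IsSymmetric := by
    intro x y
    have := hA x y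
    change inner ℝ (c • x + d • A x) y = inner ℝ x (c • y + d • A y)
    simp only [inner_add_left, inner_add_right, real_inner_smul_left, real_inner_smul_right]
    rw [show inner ℝ (A x) y = inner ℝ x (A y) from this]
  have hBb : FormBounds B (-1) 1 := by
    intro v
    obtain ⟨h1, h2⟩ := hab v
    have e : inner ℝ (B v) v = c * ‖v‖ ^ 2 + d * inner ℝ (A v) v := by
      change inner ℝ (c • v + d • A v) v = _
      rw [inner_add_left, real_inner_smul_left, real_inner_smul_left, real_inner_self_eq_norm_sq]
    have e2 : inner ℝ (B v) v = ((b + a) * ‖v‖ ^ 2 - 2 * inner ℝ (A v) v) / (b - a) := by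
      rw [e, hc, hd2]; ring
    rw [e2, le_div_iff₀ hd, div_le_iff₀ hd]
    constructor <;> nlinarith
  have hcomp : operatorCompression Q B = c • 1 + d • operatorCompression Q A := by
    ext x
    have h : adjoint Q (Q x) = x := congr($hQ x)
    change adjoint Q (c • Q x + d • A (Q x)) = c • x + d • adjoint Q (A (Q x))
    rw [map_add, map_smul, map_smul, h]
  set σ := τ * (b - a) / 2 with hσ
  have hσ0 : 0 ≤ σ := by positivity
  have hσ1 : -(τ * (b + a) / 2) + σ * c = 0 := by rw [hσ, hc]; field_simp; ring
  have hσ2 : σ * d = -τ := by rw [hσ, hd2]; field_simp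
  have key := norm_exp_smul_sub_le hB hBb hQ (hV.affine c d) hθ hσ0
  rw [exp_neg_smul_eq_smul_exp A hσ1 hσ2,
    exp_neg_smul_eq_smul_exp (operatorCompression Q A) hσ1 hσ2, ← hcomp, smul_apply, smul_apply,
    map_smul, ← smul_sub, norm_smul, Real.norm_of_nonneg (Real.exp_nonneg _)]
  calc _ ≤ Real.exp (-(τ * (b + a) / 2)) *
        (4 * Real.exp (-(k * θ)) * Real.exp (σ * Real.cosh θ) * ‖g‖) := by gcongr
    _ = 4 * (Real.exp (-(τ * (b + a) / 2)) * Real.exp (-(k * θ)) *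
        Real.exp (σ * Real.cosh θ)) * ‖g‖ := by ring
    _ = _ := by
      rw [← Real.exp_add, ← Real.exp_add]
      congr 3
      rw [hσ]; ring

/-! ### Truncation of the Neumann series -/

omit [FiniteDimensional ℝ E] [CompleteSpace E] in
lemma norm_sub_geom_sum_le {G S : E →L[ℝ] E} {q : ℝ} (hq : q < 1) (hS : ‖S‖ ≤ q)
    (hG : G * (1 - S) = 1) (m : ℕ) :
    ‖G - ∑ l ∈ Finset.range m, S ^ l‖ ≤ q ^ m / (1 - q) := by
  have h1 : G - ∑ l ∈ Finset.range m, S ^ l = G * S ^ m := by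
    calc G - ∑ l ∈ Finset.range m, S ^ l
        = G - G * (1 - S) * ∑ l ∈ Finset.range m, S ^ l := by rw [hG, one_mul]
      _ = G * S ^ m := by rw [mul_assoc, mul_neg_geom_sum]; noncomm_ring
  have h2 : ‖G‖ ≤ 1 / (1 - q) := by
    rw [le_div_iff₀ (by linarith)]
    have h3 : G = 1 + G * S := by rw [← hG]; noncomm_ring
    have h4 : ‖G‖ ≤ 1 + ‖G‖ * q := by
      calc ‖G‖ = ‖1 + G * S‖ := by rw [← h3]
        _ ≤ ‖(1 : E →L[ℝ] E)‖ + ‖G * S‖ := norm_add_le _ _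
        _ ≤ 1 + ‖G‖ * q := add_le_add norm_id_le
          ((norm_mul_le _ _).trans (by gcongr))
    linarith
  have h5 : ‖S ^ m‖ ≤ q ^ m := by
    rcases m.eq_zero_or_pos with rfl | hm
    · rw [pow_zero, pow_zero]
      exact norm_id_le
    · exact (norm_pow_le' S hm).trans (by gcongr)
  rw [h1]
  have : 0 < 1 - q := by linarith
  calc _ ≤ ‖G‖ * ‖S ^ m‖ := norm_mul_le _ _
    _ ≤ 1 / (1 - q) * q ^ m := by gcongr
    _ = _ := by ring

omit [FiniteDimensional ℝ E] [FiniteDimensional ℝ F] in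
/-- With `G = (1 - S)⁻¹` and `G' = (1 - S')⁻¹`, the comparison of `G` with `G'` reduces to that of
the powers of `S` and `S'` below `m`, up to the two Neumann remainders. -/
lemma norm_inverse_sub_compressed_inverse_le {G S : E →L[ℝ] E} {G' S' : F →L[ℝ] F}
    {q q' : ℝ} (hq : q < 1)
    (hS : ‖S‖ ≤ q) (hG : G * (1 - S) = 1) (hq' : q' < 1) (hS' : ‖S'‖ ≤ q')
    (hG' : G' * (1 - S') = 1) (Q : F →L[ℝ] E) (m : ℕ) (g : E) :
    ‖G g - Q (G' (adjoint Q g))‖ ≤ q ^ m / (1 - q) * ‖g‖ +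
      ‖Q‖ * ‖adjoint Q‖ * (q' ^ m / (1 - q')) * ‖g‖ +
      ∑ l ∈ Finset.range m, ‖(S ^ l) g - Q ((S' ^ l) (adjoint Q g))‖ := by
  set D := G - ∑ l ∈ Finset.range m, S ^ l with hD
  set D' := G' - ∑ l ∈ Finset.range m, S' ^ l with hD'
  have h1 : ‖D g‖ ≤ q ^ m / (1 - q) * ‖g‖ :=
    D.le_of_opNorm_le (norm_sub_geom_sum_le hq hS hG m) g
  have hpos : 0 < 1 - q' := by linarith
  have hq0' : 0 ≤ q' := (norm_nonneg _).trans hS'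
  have h2 : ‖Q (D' (adjoint Q g))‖ ≤ ‖Q‖ * ‖adjoint Q‖ * (q' ^ m / (1 - q')) * ‖g‖ := by
    calc _ ≤ ‖Q‖ * (q' ^ m / (1 - q') * (‖adjoint Q‖ * ‖g‖)) := by
          refine Q.le_opNorm_of_le ?_
          refine (D'.le_of_opNorm_le (norm_sub_geom_sum_le hq' hS' hG' m) _).trans ?_
          gcongr
          exact le_opNorm _ _
      _ = _ := by ring
  have e : G g - Q (G' (adjoint Q g)) = D g - Q (D' (adjoint Q g)) +
      ∑ l ∈ Finset.range m, ((S ^ l) g - Q ((S' ^ l) (adjoint Q g))) := by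
    simp only [hD, hD', sub_apply, sum_apply, map_sub, map_sum, Finset.sum_sub_distrib]
    abel
  rw [e]
  refine (norm_add_le _ _).trans (add_le_add ?_ (norm_sum_le _ _))
  exact (norm_sub_le _ _).trans (add_le_add h1 h2)

end Operators

/-! ### Estimates of the exponents -/

/-- The constant `559 / 500` is just below `√(5 / 4)`. -/
lemma sinh_le_of_le {v : ℝ} (h0 : 0 ≤ v) (h1 : v ≤ 4 / 5) : Real.sinh v ≤ 559 / 500 * v := by
  have ha : |v| ≤ 1 := by rw [abs_of_nonneg h0]; linarith
  have e1 := (abs_le.mp (Real.exp_bound ha (n := 5) (by norm_num))).2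
  have e2 := (abs_le.mp (Real.exp_bound (x := -v) (by rwa [abs_neg]) (n := 5) (by norm_num))).1
  rw [abs_neg] at e2
  rw [abs_of_nonneg h0] at e1 e2
  simp only [Finset.sum_range_succ, Finset.sum_range_zero, Nat.factorial] at e1 e2
  norm_num at e1 e2
  rw [Real.sinh_eq]
  have h2 : v ^ 2 ≤ 16 / 25 := by nlinarith
  have h3 : v ^ 3 ≤ 16 / 25 * v := by nlinarith
  have h5 : v ^ 5 ≤ 256 / 625 * v := by
    have : v ^ 5 = v ^ 3 * v ^ 2 := by ring
    nlinarith [pow_nonneg h0 3]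
  ring_nf at e1 e2
  nlinarith

/-- The Taylor coefficient `1 / 2` is enlarged to `5 / 8`, which suffices up to `z = 8 / 5`. -/
lemma cosh_sub_one_le {z : ℝ} (h0 : 0 ≤ z) (h1 : z ≤ 8 / 5) : Real.cosh z - 1 ≤ 5 / 8 * z ^ 2 := by
  have h := sinh_le_of_le (v := z / 2) (by linarith) (by linarith)
  have h2 : Real.cosh z = 1 + 2 * Real.sinh (z / 2) ^ 2 := by
    have := Real.cosh_two_mul (z / 2)
    rw [mul_div_cancel₀ z (two_ne_zero)] at this
    rw [this, Real.cosh_sq]; ring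
  have h3 : 0 ≤ Real.sinh (z / 2) := Real.sinh_nonneg_iff.mpr (by linarith)
  rw [h2]
  nlinarith [sq_nonneg z]

/-- The exponent for the parameter `θ = 8 k / (5 y)`; when `k ≤ y`, this `θ` is at most `8 / 5`, the
range of `cosh_sub_one_le`. -/
lemma exponent_le_of_le {k y s : ℝ} (hk : 0 < k) (hky : k ≤ y) (hs : s ≤ y) :
    s * ((Real.cosh (8 * k / (5 * y)) - 1) / 2) - k * (8 * k / (5 * y)) ≤
      -(4 * k ^ 2 / (5 * y)) := by
  have hy : 0 < y := hk.trans_le hky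
  have h := cosh_sub_one_le (z := 8 * k / (5 * y)) (by positivity)
    (by rw [div_le_div_iff₀ (by positivity) (by norm_num)]; linarith)
  have h1 : 0 ≤ Real.cosh (8 * k / (5 * y)) - 1 := by linarith [Real.one_le_cosh (8 * k / (5 * y))]
  calc _ ≤ y * ((5 / 8 * (8 * k / (5 * y)) ^ 2) / 2) - k * (8 * k / (5 * y)) := by gcongr
    _ = _ := by field_simp; ring

lemma cosh_log_five : (Real.cosh (Real.log 5) - 1) / 2 = 4 / 5 := by
  rw [Real.cosh_log (by norm_num)]; norm_num

/-- The exponent for the parameter `θ = log 5` on the interval `[x / 2, ρ]`, when `ρ m ≤ k`. The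
left side exceeds `-(x m) - k log 5` by `4 ρ l / 5 + x (m - 9 l / 10)`, which increases with `x`, so
that the extreme case is `x = ρ`. -/
lemma exponent_le_of_mul_le {k l m x ρ : ℝ} (hl : 0 ≤ l) (hlm : l ≤ m) (hx0 : 0 ≤ x) (hx : x ≤ ρ)
    (hk : ρ * m ≤ k) :
    -(l * (x / 2)) + l * (ρ - x / 2) * ((Real.cosh (Real.log 5) - 1) / 2) - k * Real.log 5 ≤
      -(x * m) + (k - k * Real.log 5) := by
  rw [cosh_log_five]
  nlinarith [mul_nonneg (sub_nonneg.mpr hx) (sub_nonneg.mpr hlm), mul_nonneg (hx0.trans hx) hl,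
    mul_nonneg (sub_nonneg.mpr hx) hl]

lemma four_mul_exp_le {k : ℝ} (hk : 3 ≤ k) : 4 * Real.exp (k - k * Real.log 5) ≤ 1 := by
  have h5 : Real.log 5 = Real.log 4 + Real.log (5 / 4) := by
    rw [← Real.log_mul (by norm_num) (by norm_num)]; norm_num
  have h4 : Real.log 4 = 2 * Real.log 2 := by
    rw [show (4 : ℝ) = 2 ^ 2 by norm_num, Real.log_pow]; norm_num
  have h2 := Real.log_two_gt_d9
  have h6 : 1 / 5 ≤ Real.log (5 / 4) := by
    have := Real.one_sub_inv_le_log_of_pos (show (0 : ℝ) < 5 / 4 by norm_num)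
    linarith
  have hl : 1.58 ≤ Real.log 5 := by linarith
  have h7 : k - k * Real.log 5 ≤ - Real.log 4 := by
    have : Real.log 4 ≤ 1.39 := by linarith [Real.log_two_lt_d9]
    nlinarith
  calc _ ≤ 4 * Real.exp (-Real.log 4) := by gcongr
    _ = 1 := by rw [Real.exp_neg, Real.exp_log (by norm_num)]; norm_num

/-! ### The error bound for operators -/

section ErrorBound

variable {E F : Type*} [NormedAddCommGroup E] [InnerProductSpace ℝ E] [NormedAddCommGroup F]
  [InnerProductSpace ℝ F] [FiniteDimensional ℝ E] [FiniteDimensional ℝ F] [CompleteSpace E]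
  [CompleteSpace F]

/-- The error for a single exponential `e^{-lA}` with `l ≤ m`. The second summand bounds it when
`k ≤ y`, the first when `y ≤ k`. -/
lemma norm_exp_neg_smul_sub_le_add {A : E →L[ℝ] E} (hA : (A : E →ₗ[ℝ] E).IsSymmetric)
    {a ρ : ℝ} (ha : 0 < a) (hab : FormBounds A a ρ) {Q : F →L[ℝ] E} (hQ : adjoint Q ∘L Q = 1)
    {g : E} (hg : g ≠ 0) {k m l : ℕ} {V : ℕ → Submodule ℝ E} (hV : IsKrylovFlag A Q g k V)
    (hk : 3 ≤ k) (hl : l ≤ m) {y : ℝ} (hy : ρ * m ≤ y) :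
    ‖NormedSpace.exp (-((l : ℝ) • A)) g -
        Q (NormedSpace.exp (-((l : ℝ) • operatorCompression Q A)) (adjoint Q g))‖ ≤
      (Real.exp (-(a * m)) + 4 * Real.exp (-(4 * (k : ℝ) ^ 2 / (5 * y)))) * ‖g‖ := by
  have haρ : a ≤ ρ := hab.le hg
  have hk0 : (0 : ℝ) < k := by exact_mod_cast (by omega : 0 < k)
  have hlm : (l : ℝ) ≤ m := by exact_mod_cast hl
  have hl0 : (0 : ℝ) ≤ l := l.cast_nonneg
  -- Halving the lower end keeps the interval nondegenerate even if `a = ρ`, and still gains a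
  -- factor `e^{-la/2}`.
  have hab' := hab.mono_left (show a / 2 ≤ a by linarith)
  have hlt : a / 2 < ρ := by linarith
  rcases le_total (k : ℝ) y with hky | hky
  · have hy0 : 0 < y := hk0.trans_le hky
    refine (norm_exp_neg_smul_sub_le hA hlt hab' hQ hV
      (θ := 8 * k / (5 * y)) (by positivity) hl0).trans ?_
    have hs : l * (ρ - a / 2) ≤ y := by
      refine le_trans ?_ hy
      rw [mul_comm ρ]
      exact mul_le_mul hlm (by linarith) (by linarith) (by linarith)
    have h1 := exponent_le_of_le hk0 hky hs
    have h2 : 0 ≤ l * (a / 2) := by positivity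
    have h3 : Real.exp (-(l * (a / 2)) + l * (ρ - a / 2) *
        ((Real.cosh (8 * k / (5 * y)) - 1) / 2) - k * (8 * k / (5 * y))) ≤
        Real.exp (-(4 * (k : ℝ) ^ 2 / (5 * y))) := Real.exp_le_exp.mpr (by linarith)
    gcongr
    have := Real.exp_pos (-(a * m))
    linarith
  · refine (norm_exp_neg_smul_sub_le hA hlt hab' hQ hV (Real.log_nonneg (by norm_num : (1 : ℝ) ≤ 5))
      hl0).trans ?_
    have h1 := exponent_le_of_mul_le hl0 hlm ha.le haρ (hy.trans hky)
    have h2 := four_mul_exp_le (k := k) (by exact_mod_cast hk)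
    have h3 := Real.exp_le_exp.mpr h1
    rw [Real.exp_add] at h3
    have h4 := Real.exp_pos (-(a * m))
    have h5 := Real.exp_pos (-(4 * (k : ℝ) ^ 2 / (5 * y)))
    gcongr
    nlinarith

/-- The error bound for `b(A)`, with `G` and `G'` in the roles of `b(A)` and `b(Q† A Q)`, and
with any upper bound `y` of `ρ m`. One of the `k` copies of `e^{-am} / (1 - e^{-a})` is the
Neumann remainder, the others absorb the terms `e^{-am}` of the exponentials `e^{-lA}`,
`1 ≤ l < m`. -/
theorem norm_inverse_one_sub_exp_sub_le {A : E →L[ℝ] E} (hA : (A : E →ₗ[ℝ] E).IsSymmetric)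
    {a ρ μ ρ' : ℝ} (ha : 0 < a) (hab : FormBounds A a ρ) {Q : F →L[ℝ] E}
    (hQ : adjoint Q ∘L Q = 1) (hμ : 0 < μ) (hab' : FormBounds (operatorCompression Q A) μ ρ')
    {g : E} (hg : g ≠ 0) {k m : ℕ} {V : ℕ → Submodule ℝ E} (hV : IsKrylovFlag A Q g k V)
    (hm : 1 ≤ m) (hmk : m ≤ k) (hk : 2 ≤ m → 3 ≤ k) {y : ℝ} (hy : ρ * m ≤ y)
    {G : E →L[ℝ] E} {G' : F →L[ℝ] F} (hG : G * (1 - NormedSpace.exp (-A)) = 1)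
    (hG' : G' * (1 - NormedSpace.exp (-operatorCompression Q A)) = 1) :
    ‖G g - Q (G' (adjoint Q g))‖ ≤
      (k * (Real.exp (-(a * m)) / (1 - Real.exp (-a))) +
        ‖Q‖ * ‖adjoint Q‖ * (Real.exp (-(μ * m)) / (1 - Real.exp (-μ))) +
        4 * ((m : ℝ) - 1) * Real.exp (-(4 * (k : ℝ) ^ 2 / (5 * y)))) * ‖g‖ := by
  have hqa : Real.exp (-a) < 1 := Real.exp_lt_one_iff.mpr (by linarith)
  have hqμ : Real.exp (-μ) < 1 := Real.exp_lt_one_iff.mpr (by linarith)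
  have hpow : ∀ t : ℝ, Real.exp (-(t * m)) = Real.exp (-t) ^ m := fun t => by
    rw [← Real.exp_nat_mul]; ring_nf
  have h0 := norm_inverse_sub_compressed_inverse_le hqa (norm_exp_neg_le hA hab) hG hqμ
    (norm_exp_neg_le (isSymmetric_operatorCompression hA Q) hab') hG' Q m g
  set ε := (Real.exp (-(a * m)) + 4 * Real.exp (-(4 * (k : ℝ) ^ 2 / (5 * y)))) * ‖g‖ with hε
  have hsum : ∑ l ∈ Finset.range m, ‖(NormedSpace.exp (-A) ^ l) g -
      Q ((NormedSpace.exp (-operatorCompression Q A) ^ l) (adjoint Q g))‖ ≤ ((m : ℝ) - 1) * ε := by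
    obtain ⟨n, rfl⟩ : ∃ n, m = n + 1 := ⟨m - 1, by omega⟩
    -- the term `l = 0` vanishes, which leaves `m - 1` terms
    have hz : ‖(NormedSpace.exp (-A) ^ 0) g -
        Q ((NormedSpace.exp (-operatorCompression Q A) ^ 0) (adjoint Q g))‖ = 0 := by
      have := hV.galerkinError_eq_zero hQ (p := 1) (by rw [natDegree_one]; omega)
      rw [galerkinError, map_one, map_one] at this
      rw [pow_zero, pow_zero, this, norm_zero]
    rw [Finset.sum_range_succ', hz, add_zero]
    refine (Finset.sum_le_card_nsmul _ _ ε fun l hl => ?_).trans_eq ?_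
    · rw [Finset.mem_range] at hl
      rw [exp_neg_pow, exp_neg_pow]
      exact norm_exp_neg_smul_sub_le_add hA ha hab hQ hg hV (hk (by omega)) (by omega) hy
    · simp
  refine (h0.trans (add_le_add le_rfl hsum)).trans ?_
  rw [← hpow, ← hpow, hε]
  set ea := Real.exp (-(a * m)) with hea
  have hea0 : 0 < ea := Real.exp_pos _
  have h1 : ((m : ℝ) - 1) * ea ≤ ((k : ℝ) - 1) * (ea / (1 - Real.exp (-a))) := by
    have hm1 : (1 : ℝ) ≤ m := by exact_mod_cast hm
    have hmk' : (m : ℝ) ≤ k := by exact_mod_cast hmk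
    have : ea ≤ ea / (1 - Real.exp (-a)) :=
      le_div_self hea0.le (by linarith) (by linarith [Real.exp_pos (-a)])
    exact mul_le_mul (by linarith) this hea0.le (by linarith)
  have h2 := mul_le_mul_of_nonneg_right h1 (norm_nonneg g)
  linarith

end ErrorBound

/-! ### Matrices as operators on Euclidean space -/

lemma euclMap_apply {p q : ℕ} (M : Matrix (Fin p) (Fin q) ℝ) (x : EuclideanSpace ℝ (Fin q)) :
    euclMap M x = WithLp.toLp 2 (M.mulVec x.ofLp) := rfl

lemma euclMap_eq_toEuclideanCLM {p : ℕ} (M : Matrix (Fin p) (Fin p) ℝ) :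
    euclMap M = Matrix.toEuclideanCLM (𝕜 := ℝ) M := rfl

lemma euclMap_mul {p q r : ℕ} (M : Matrix (Fin p) (Fin q) ℝ) (N : Matrix (Fin q) (Fin r) ℝ) :
    euclMap (M * N) = euclMap M ∘L euclMap N := by
  ext1 x
  rw [comp_apply, euclMap_apply, euclMap_apply, euclMap_apply, Matrix.mulVec_mulVec]

lemma euclMap_one {p : ℕ} : euclMap (1 : Matrix (Fin p) (Fin p) ℝ) = 1 := by
  rw [euclMap_eq_toEuclideanCLM, map_one]

lemma adjoint_euclMap {p q : ℕ} (M : Matrix (Fin p) (Fin q) ℝ) :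
    adjoint (euclMap M) = euclMap M.transpose := by
  symm
  rw [eq_adjoint_iff]
  intro x y
  have h := Matrix.toEuclideanLin_conjTranspose_eq_adjoint M
  rw [Matrix.conjTranspose_eq_transpose_of_trivial] at h
  change inner ℝ (Matrix.toEuclideanLin M.transpose x) y = inner ℝ x (Matrix.toEuclideanLin M y)
  rw [h, LinearMap.adjoint_inner_left]

lemma euclMap_exp {p : ℕ} (M : Matrix (Fin p) (Fin p) ℝ) :
    euclMap (NormedSpace.exp M) = NormedSpace.exp (euclMap M) := by
  -- the operator norm makes matrices a normed algebra without changing their topology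
  open scoped Matrix.Norms.L2Operator in
  let _ : NormedAlgebra ℚ (Matrix (Fin p) (Fin p) ℝ) := NormedAlgebra.restrictScalars ℚ ℝ _
  exact NormedSpace.map_exp (Matrix.toEuclideanCLM (𝕜 := ℝ) (n := Fin p))
    (LinearMap.continuous_of_finiteDimensional
      (Matrix.toEuclideanCLM (𝕜 := ℝ) (n := Fin p)).toAlgEquiv.toLinearMap) M

lemma isUnit_euclMap_iff {p : ℕ} {M : Matrix (Fin p) (Fin p) ℝ} :
    IsUnit (euclMap M) ↔ IsUnit M :=
  isUnit_map_iff (Matrix.toEuclideanCLM (𝕜 := ℝ) (n := Fin p)) M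

lemma euclMap_isSymmetric {p : ℕ} {M : Matrix (Fin p) (Fin p) ℝ} (hM : M.IsHermitian) :
    (euclMap M : EuclideanSpace ℝ (Fin p) →ₗ[ℝ] EuclideanSpace ℝ (Fin p)).IsSymmetric :=
  Matrix.isSymmetric_toEuclideanLin_iff.mpr hM

lemma mem_spectrum_iff_exists {p : ℕ} {M : Matrix (Fin p) (Fin p) ℝ} {t : ℝ} :
    t ∈ spectrum ℝ M ↔ ∃ v : EuclideanSpace ℝ (Fin p), v ≠ 0 ∧ euclMap M v = t • v := by
  rw [← Matrix.spectrum_toLpLin 2, ← Module.End.hasEigenvalue_iff_mem_spectrum]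
  constructor
  · intro h
    obtain ⟨v, hv⟩ := h.exists_hasEigenvector
    exact ⟨v, hv.2, hv.apply_eq_smul⟩
  · rintro ⟨v, hv0, hv⟩
    exact Module.End.hasEigenvalue_of_hasEigenvector
      ⟨Module.End.mem_eigenspace_iff.mpr hv, hv0⟩

lemma formBounds_of_spectrum_subset {p : ℕ} {M : Matrix (Fin p) (Fin p) ℝ} (hM : M.IsHermitian)
    {a b : ℝ} (h : spectrum ℝ M ⊆ Set.Icc a b) : FormBounds (euclMap M) a b := by
  intro v
  have hs := euclMap_isSymmetric hM
  set e := hs.eigenvectorBasis rfl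
  set t := hs.eigenvalues rfl
  have het : ∀ i, euclMap M (e i) = t i • e i := hs.apply_eigenvectorBasis rfl
  have ht : ∀ i, t i ∈ Set.Icc a b := fun i =>
    h (mem_spectrum_iff_exists.mpr ⟨e i, e.orthonormal.ne_zero i, het i⟩)
  have h1 : inner ℝ (euclMap M v) v = ∑ i, t i * inner ℝ v (e i) ^ 2 := by
    rw [← e.sum_inner_mul_inner]
    refine Finset.sum_congr rfl fun i _ => ?_
    have : inner ℝ (euclMap M v) (e i) = inner ℝ v (euclMap M (e i)) := hs _ _
    rw [this, het, real_inner_smul_right, real_inner_comm v (e i)]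
    ring
  have h2 : ‖v‖ ^ 2 = ∑ i, inner ℝ v (e i) ^ 2 := by
    rw [← real_inner_self_eq_norm_sq, ← e.sum_inner_mul_inner]
    exact Finset.sum_congr rfl fun i _ => by rw [real_inner_comm v (e i)]; ring
  rw [h1, h2, Finset.mul_sum, Finset.mul_sum]
  exact ⟨Finset.sum_le_sum fun i _ => mul_le_mul_of_nonneg_right (ht i).1 (sq_nonneg _),
    Finset.sum_le_sum fun i _ => mul_le_mul_of_nonneg_right (ht i).2 (sq_nonneg _)⟩

lemma FormBounds.spectrum_subset {p : ℕ} {M : Matrix (Fin p) (Fin p) ℝ} {a b : ℝ}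
    (h : FormBounds (euclMap M) a b) : spectrum ℝ M ⊆ Set.Icc a b := by
  intro t ht
  obtain ⟨v, hv, hMv⟩ := mem_spectrum_iff_exists.mp ht
  exact h.eigenvalue_mem hv hMv

lemma inv_smul_mem_spectrum {p : ℕ} {M : Matrix (Fin p) (Fin p) ℝ} {T t : ℝ} (hT : T ≠ 0)
    (ht : t ∈ spectrum ℝ (T • M)) : T⁻¹ * t ∈ spectrum ℝ M := by
  rw [mem_spectrum_iff_exists] at ht ⊢
  obtain ⟨v, hv, hMv⟩ := ht
  rw [euclMap_eq_toEuclideanCLM, map_smul] at hMv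
  refine ⟨v, hv, ?_⟩
  rw [mul_smul, ← hMv, smul_apply, smul_smul, inv_mul_cancel₀ hT, one_smul]
  rfl

lemma spectrum_smul_le {p : ℕ} {M : Matrix (Fin p) (Fin p) ℝ} {T a t : ℝ} (hT : 0 < T)
    (ha : IsLeast (spectrum ℝ M) a) (ht : t ∈ spectrum ℝ (T • M)) : T * a ≤ t := by
  have := ha.2 (inv_smul_mem_spectrum hT.ne' ht)
  rwa [inv_mul_eq_div, le_div_iff₀' hT] at this

lemma euclMap_one_sub_exp_neg {p : ℕ} (M : Matrix (Fin p) (Fin p) ℝ) :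
    euclMap (1 - NormedSpace.exp (-M)) = 1 - NormedSpace.exp (-euclMap M) := by
  have h : -euclMap M = euclMap (-M) := by
    simp only [euclMap_eq_toEuclideanCLM, map_neg]
  rw [h, ← euclMap_exp]
  simp only [euclMap_eq_toEuclideanCLM, map_sub, map_one]

lemma isUnit_one_sub_exp {p : ℕ} {M : Matrix (Fin p) (Fin p) ℝ} (hM : M.IsHermitian) {a b : ℝ}
    (ha : 0 < a) (h : FormBounds (euclMap M) a b) : IsUnit (1 - NormedSpace.exp (-M)) := by
  rw [← isUnit_euclMap_iff, euclMap_one_sub_exp_neg]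
  exact isUnit_one_sub_of_norm_lt_one
    ((norm_exp_neg_le (euclMap_isSymmetric hM) h).trans_lt (Real.exp_lt_one_iff.mpr (by linarith)))

lemma euclMap_matB_mul {p : ℕ} {M : Matrix (Fin p) (Fin p) ℝ}
    (h : IsUnit (1 - NormedSpace.exp (-M))) :
    euclMap (matB M) * (1 - NormedSpace.exp (-euclMap M)) = 1 := by
  rw [← euclMap_one_sub_exp_neg, euclMap_eq_toEuclideanCLM, euclMap_eq_toEuclideanCLM, ← map_mul,
    matB, Matrix.nonsing_inv_mul _ ((Matrix.isUnit_iff_isUnit_det _).mp h), map_one]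

/-! ### The Arnoldi procedure -/

section Arnoldi

variable {n k : ℕ} {A : Matrix (Fin n) (Fin n) ℝ} {g : EuclideanSpace ℝ (Fin n)}
  {Q : Matrix (Fin n) (Fin k) ℝ} {H : Matrix (Fin k) (Fin k) ℝ}

/-- The columns of `Q` are orthonormal. The statement is cut off at `N` so that it can be proved by
induction along the procedure. -/
lemma IsArnoldi.inner_euclCol (h : IsArnoldi A g Q H) (N : ℕ) :
    ∀ i j : Fin k, (i : ℕ) ≤ N → (j : ℕ) ≤ N →
      inner ℝ (euclCol Q i) (euclCol Q j) = if i = j then (1 : ℝ) else 0 := by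
  have hself : ∀ j : Fin k, inner ℝ (euclCol Q j) (euclCol Q j) = (1 : ℝ) := by
    intro j
    rw [real_inner_self_eq_norm_sq]
    have : ‖euclCol Q j‖ = 1 := by
      rcases Nat.eq_zero_or_eq_succ_pred (j : ℕ) with hj | hj
      · rw [h.first_col j hj, norm_smul, norm_inv, norm_norm,
          inv_mul_cancel₀ (norm_ne_zero_iff.mpr h.start_ne_zero)]
      · have hi : (j : ℕ).pred < k := by have := j.2; omega
        rw [h.next_col ⟨_, hi⟩ j hj, norm_smul, norm_inv, norm_norm,
          inv_mul_cancel₀ (norm_ne_zero_iff.mpr (h.no_breakdown _ j hj))]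
    rw [this, one_pow]
  induction N with
  | zero =>
    intro i j hi hj
    obtain rfl : i = j := Fin.ext (by omega)
    rw [hself, if_pos rfl]
  | succ N ih =>
    have key : ∀ i j : Fin k, (i : ℕ) ≤ N → (j : ℕ) = N + 1 →
        inner ℝ (euclCol Q i) (euclCol Q j) = (0 : ℝ) := by
      intro i j hi hj
      have hN : N < k := by have := j.2; omega
      have hres : inner ℝ (euclCol Q i) (arnoldiResidual A Q ⟨N, hN⟩) = (0 : ℝ) := by
        rw [arnoldiResidual, inner_sub_right, inner_sum]
        simp only [real_inner_smul_right]
        rw [Finset.sum_eq_single_of_mem i (Finset.mem_Iic.mpr (Fin.le_def.mpr hi)), hself,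
          mul_one, sub_self]
        intro b hb hbi
        rw [ih i b hi (Fin.le_def.mp (Finset.mem_Iic.mp hb)), if_neg (Ne.symm hbi), mul_zero]
      rw [h.next_col ⟨N, hN⟩ j hj, real_inner_smul_right, hres, mul_zero]
    intro i j hi hj
    by_cases hij : i = j
    · rw [if_pos hij, hij, hself]
    rw [if_neg hij]
    rcases Nat.lt_or_ge N i with hi' | hi' <;> rcases Nat.lt_or_ge N j with hj' | hj'
    · exact absurd (Fin.ext (by omega)) hij
    · rw [real_inner_comm]; exact key j i hj' (by omega)
    · exact key i j hi' (by omega)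
    · rw [ih i j hi' hj', if_neg hij]

lemma IsArnoldi.transpose_mul_self (h : IsArnoldi A g Q H) : Q.transpose * Q = 1 := by
  ext i j
  rw [Matrix.one_apply, ← h.inner_euclCol (max i j) i j (le_max_left _ _) (le_max_right _ _)]
  simp [Matrix.mul_apply, euclCol, PiLp.inner_apply, mul_comm]

lemma IsArnoldi.adjoint_comp_self (h : IsArnoldi A g Q H) :
    adjoint (euclMap Q) ∘L euclMap Q = 1 := by
  rw [adjoint_euclMap, ← euclMap_mul, h.transpose_mul_self, euclMap_one]

lemma euclMap_single (Q : Matrix (Fin n) (Fin k) ℝ) (j : Fin k) :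
    euclMap Q (EuclideanSpace.single j 1) = euclCol Q j := by
  rw [euclMap_apply]
  ext i
  simp [euclCol]

/-- The spans of the leading columns of `Q` form a Krylov flag: solving the recursion for `A q_i`
expresses it through `q_0, …, q_{i+1}`. -/
lemma IsArnoldi.isKrylovFlag (h : IsArnoldi A g Q H) (hk : 0 < k) :
    IsKrylovFlag (euclMap A) (euclMap Q) g k
      (fun j => Submodule.span ℝ (euclCol Q '' {i | (i : ℕ) ≤ j})) where
  mono := fun a b hab => Submodule.span_mono (Set.image_mono fun i hi => le_trans hi hab)
  start := by
    have h0 := h.first_col ⟨0, hk⟩ rfl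
    have : g = ‖g‖ • euclCol Q ⟨0, hk⟩ := by
      rw [h0, smul_smul, mul_inv_cancel₀ (norm_ne_zero_iff.mpr h.start_ne_zero), one_smul]
    rw [this]
    exact Submodule.smul_mem _ _ (Submodule.subset_span ⟨⟨0, hk⟩, le_refl (0 : ℕ), rfl⟩)
  map := by
    intro j hj v hv
    have hsub : Submodule.span ℝ (euclCol Q '' {i | (i : ℕ) ≤ j}) ≤
        (Submodule.span ℝ (euclCol Q '' {i | (i : ℕ) ≤ j + 1})).comap
          (euclMap A : EuclideanSpace ℝ (Fin n) →ₗ[ℝ] EuclideanSpace ℝ (Fin n)) := by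
      rw [Submodule.span_le]
      rintro _ ⟨i, hi, rfl⟩
      have hi' : (i : ℕ) ≤ j := hi
      have hi1 : (i : ℕ) + 1 < k := by omega
      change euclMap A (euclCol Q i) ∈
        Submodule.span ℝ (euclCol Q '' {i | (i : ℕ) ≤ j + 1})
      have hn := h.next_col i ⟨i + 1, hi1⟩ rfl
      have hb := h.no_breakdown i ⟨i + 1, hi1⟩ rfl
      have e : euclMap A (euclCol Q i) = arnoldiResidual A Q i +
          ∑ l ∈ Finset.Iic i, (inner ℝ (euclCol Q l) (euclMap A (euclCol Q i))) • euclCol Q l := by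
        rw [arnoldiResidual, sub_add_cancel]
      have e2 : arnoldiResidual A Q i = ‖arnoldiResidual A Q i‖ • euclCol Q ⟨i + 1, hi1⟩ := by
        rw [hn, smul_smul, mul_inv_cancel₀ (norm_ne_zero_iff.mpr hb), one_smul]
      rw [e, e2]
      refine Submodule.add_mem _ (Submodule.smul_mem _ _ (Submodule.subset_span
        ⟨_, show (i : ℕ) + 1 ≤ j + 1 by omega, rfl⟩)) (Submodule.sum_mem _ fun l hl =>
          Submodule.smul_mem _ _ (Submodule.subset_span ⟨l, ?_, rfl⟩))
      have := Fin.le_def.mp (Finset.mem_Iic.mp hl)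
      exact show (l : ℕ) ≤ j + 1 by omega
    exact hsub hv
  le_range := by
    intro j _ v hv
    have hsub : Submodule.span ℝ (euclCol Q '' {i | (i : ℕ) ≤ j}) ≤
        LinearMap.range (euclMap Q : EuclideanSpace ℝ (Fin k) →ₗ[ℝ] EuclideanSpace ℝ (Fin n)) := by
      rw [Submodule.span_le]
      rintro _ ⟨i, _, rfl⟩
      exact ⟨_, euclMap_single Q i⟩
    exact hsub hv

lemma IsArnoldi.le_dim (h : IsArnoldi A g Q H) : k ≤ n := by
  have hinj : Function.Injective
      (euclMap Q : EuclideanSpace ℝ (Fin k) →ₗ[ℝ] EuclideanSpace ℝ (Fin n)) := by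
    rw [injective_iff_map_eq_zero]
    intro x hx
    have := norm_map_of_adjoint_comp_self h.adjoint_comp_self x
    rw [show euclMap Q x = 0 from hx, norm_zero] at this
    exact norm_eq_zero.mp this.symm
  simpa using LinearMap.finrank_le_finrank_of_injective hinj

lemma IsArnoldi.compression_eq (h : IsArnoldi A g Q H) (T : ℝ) :
    operatorCompression (euclMap Q) (euclMap (T • A)) = euclMap (T • H) := by
  rw [operatorCompression, adjoint_euclMap, ← euclMap_mul, ← euclMap_mul, h.compression,
    Matrix.smul_mul, Matrix.mul_smul, Matrix.mul_assoc]

lemma IsArnoldi.isHermitian (h : IsArnoldi A g Q H) (hA : A.IsHermitian) : H.IsHermitian := by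
  rw [h.compression, ← Matrix.conjTranspose_eq_transpose_of_trivial]
  exact Matrix.isHermitian_conjTranspose_mul_mul Q hA

end Arnoldi

/-- Bounds for `m = ⌊k ^ β⌋`. As `k ^ β < k` for `k > 1`, the case `m ≥ 2` requires `k ≥ 3`. -/
lemma floor_rpow_bounds {k : ℕ} (hk : 0 < k) {β : ℝ} (hβ0 : 0 < β) (hβ1 : β < 1) {m : ℕ}
    (hm : m = ⌊(k : ℝ) ^ β⌋₊) :
    1 ≤ m ∧ m ≤ k ∧ (2 ≤ m → 3 ≤ k) ∧ (m : ℝ) ≤ (k : ℝ) ^ β := by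
  have hk1 : (1 : ℝ) ≤ k := by exact_mod_cast hk
  have h1 : (m : ℝ) ≤ (k : ℝ) ^ β := by
    rw [hm]; exact Nat.floor_le (by positivity)
  have h2 : (k : ℝ) ^ β ≤ k := by
    simpa using Real.rpow_le_rpow_of_exponent_le hk1 hβ1.le
  refine ⟨?_, by exact_mod_cast h1.trans h2, fun h2m => ?_, h1⟩
  · rw [hm]; exact Nat.one_le_floor_iff _ |>.mpr (Real.one_le_rpow hk1 hβ0.le)
  · have h3 : (2 : ℝ) ≤ m := by exact_mod_cast h2m
    have hk1' : (1 : ℝ) < k := by linarith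
    have h4 : (k : ℝ) ^ β < k := by
      simpa using Real.rpow_lt_rpow_of_exponent_lt hk1' hβ1
    have : (2 : ℝ) < k := by linarith
    exact_mod_cast this

theorem mainTheorem2 (N d k : ℕ) (hk : 0 < k) (T β : ℝ) (hT : 0 < T) (hβ0 : 0 < β) (hβ1 : β < 1)
    (A : Matrix (Fin (N ^ d)) (Fin (N ^ d)) ℝ) (hA : A.PosDef)
    (g : EuclideanSpace ℝ (Fin (N ^ d)))
    (Q : Matrix (Fin (N ^ d)) (Fin k) ℝ) (H : Matrix (Fin k) (Fin k) ℝ)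
    (hQH : IsArnoldi A g Q H)
    (lam₁ μ₁ ρ : ℝ) (hlam : IsLeast (spectrum ℝ A) lam₁) (hμ : IsLeast (spectrum ℝ H) μ₁)
    (hρ : spectrum ℝ (T • A) ⊆ Set.Icc 0 ρ)
    (m : ℕ) (hm : m = ⌊(k : ℝ) ^ β⌋₊)
    (C : ℝ) (hC : C = ‖euclMap Q‖ * ‖euclMap Q.transpose‖) :
    0 < μ₁ ∧
    IsUnit (1 - NormedSpace.exp (-(T • A))) ∧
    IsUnit (1 - NormedSpace.exp (-(T • H))) ∧
    ‖euclMap (matB (T • A)) g - euclMap (Q * matB (T • H) * Q.transpose) g‖ ≤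
      ((N : ℝ) ^ d * Real.exp (-T * lam₁ * m) * (1 / (1 - Real.exp (-T * lam₁)) ^ (m + 1)) +
        C * k * Real.exp (-T * μ₁ * m) * (1 / (1 - Real.exp (-T * μ₁)) ^ (m + 1)) +
        10 * ((m : ℝ) - 1) * Real.exp (-(4 * (k : ℝ) ^ (2 - β) / (5 * ρ)))) * ‖g‖ := by
  have hQ := hQH.adjoint_comp_self
  have hg := hQH.start_ne_zero
  have hTA : (T • A).IsHermitian := hA.isHermitian.smul (IsSelfAdjoint.all T)
  have hTH : (T • H).IsHermitian :=
    (hQH.isHermitian hA.isHermitian).smul (IsSelfAdjoint.all T)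
  have hlam0 : 0 < lam₁ := by
    have h1 := hlam.1
    rw [hA.isHermitian.spectrum_real_eq_range_eigenvalues] at h1
    obtain ⟨i, hi⟩ := h1
    rw [← hi]
    exact hA.eigenvalues_pos i
  have hb : FormBounds (euclMap (T • A)) (T * lam₁) ρ :=
    formBounds_of_spectrum_subset hTA fun t ht => ⟨spectrum_smul_le hT hlam ht, (hρ ht).2⟩
  -- the quadratic form of `H` is a restriction of that of `A`, so `μ₁ ≥ lam₁ > 0`
  have hbH : FormBounds (euclMap (T • H)) (T * lam₁) ρ := by
    rw [← hQH.compression_eq]; exact hb.compress hQ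
  have hTlam : 0 < T * lam₁ := by positivity
  have hμT : T * μ₁ ∈ spectrum ℝ (T • H) := by
    obtain ⟨v, hv, hHv⟩ := mem_spectrum_iff_exists.mp hμ.1
    refine mem_spectrum_iff_exists.mpr ⟨v, hv, ?_⟩
    rw [euclMap_eq_toEuclideanCLM, map_smul, smul_apply,
      ← euclMap_eq_toEuclideanCLM, hHv, smul_smul]
  have hTμ : 0 < T * μ₁ := hTlam.trans_le (hbH.spectrum_subset hμT).1
  have hμ0 : 0 < μ₁ := (mul_pos_iff_of_pos_left hT).mp hTμ
  have hbH' : FormBounds (euclMap (T • H)) (T * μ₁) ρ :=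
    formBounds_of_spectrum_subset hTH fun t ht =>
      ⟨spectrum_smul_le hT hμ ht, (hbH.spectrum_subset ht).2⟩
  have hUA := isUnit_one_sub_exp hTA hTlam hb
  have hUH := isUnit_one_sub_exp hTH hTμ hbH'
  refine ⟨hμ0, hUA, hUH, ?_⟩
  obtain ⟨hm1, hmk, hk3, hmβ⟩ := floor_rpow_bounds hk hβ0 hβ1 hm
  have hρ0 : 0 < ρ := hTlam.trans_le (hb.le hg)
  have hkpos : (0 : ℝ) < k := by exact_mod_cast hk
  have hV : IsKrylovFlag (euclMap (T • A)) (euclMap Q) g k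
      (fun j => Submodule.span ℝ (euclCol Q '' {i | (i : ℕ) ≤ j})) := by
    have := (hQH.isKrylovFlag hk).affine 0 T
    rw [zero_smul, zero_add] at this
    rwa [euclMap_eq_toEuclideanCLM, map_smul]
  have hmain := norm_inverse_one_sub_exp_sub_le (euclMap_isSymmetric hTA) hTlam hb hQ hTμ
    (by rw [hQH.compression_eq]; exact hbH') hg hV hm1 hmk hk3 (y := ρ * (k : ℝ) ^ β)
    (by gcongr) (euclMap_matB_mul hUA)
    (G' := euclMap (matB (T • H))) (by rw [hQH.compression_eq]; exact euclMap_matB_mul hUH)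
  have hexp : 4 * (k : ℝ) ^ 2 / (5 * (ρ * (k : ℝ) ^ β)) = 4 * (k : ℝ) ^ (2 - β) / (5 * ρ) := by
    rw [Real.rpow_sub hkpos, Real.rpow_two]
    field_simp
  have hQG : euclMap (Q * matB (T • H) * Q.transpose) g =
      euclMap Q (euclMap (matB (T • H)) (adjoint (euclMap Q) g)) := by
    rw [euclMap_mul, euclMap_mul, adjoint_euclMap]; rfl
  rw [hexp, ← hQG, adjoint_euclMap, ← hC] at hmain
  refine hmain.trans (mul_le_mul_of_nonneg_right ?_ (norm_nonneg g))
  have hC0 : 0 ≤ C := by rw [hC]; positivity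
  have hdim : (k : ℝ) ≤ (N : ℝ) ^ d := by exact_mod_cast hQH.le_dim
  have hk1 : (1 : ℝ) ≤ k := by exact_mod_cast hk
  have hm1' : (1 : ℝ) ≤ m := by exact_mod_cast hm1
  -- a denominator in `(0, 1)` only shrinks when it is raised to a power
  have hfrac : ∀ t : ℝ, 0 < t → Real.exp (-(t * m)) / (1 - Real.exp (-t)) ≤
      Real.exp (-(t * m)) * (1 / (1 - Real.exp (-t)) ^ (m + 1)) := by
    intro t ht
    have h1 : Real.exp (-t) < 1 := Real.exp_lt_one_iff.mpr (by linarith)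
    have h2 := Real.exp_pos (-t)
    rw [div_eq_mul_one_div]
    have h3 : (0 : ℝ) < 1 - Real.exp (-t) := by linarith
    have h4 : (1 - Real.exp (-t)) ^ (m + 1) ≤ 1 - Real.exp (-t) :=
      pow_le_of_le_one h3.le (by linarith) (by omega)
    gcongr
  have hA1 := hfrac _ hTlam
  have hH1 := hfrac _ hTμ
  have hpos : ∀ t : ℝ, 0 < t → 0 ≤ Real.exp (-(t * m)) / (1 - Real.exp (-t)) := fun t ht =>
    div_nonneg (Real.exp_nonneg _) (by linarith [Real.exp_lt_one_iff.mpr (show -t < 0 by linarith)])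
  simp only [neg_mul] at hA1 hH1 ⊢
  rw [mul_assoc ((N : ℝ) ^ d), mul_assoc (C * k)]
  refine add_le_add (add_le_add ?_ ?_) ?_
  · exact mul_le_mul hdim hA1 (hpos _ hTlam) (by positivity)
  · exact mul_le_mul (le_mul_of_one_le_right hC0 hk1) hH1 (hpos _ hTμ) (by positivity)
  · have : 0 ≤ (m : ℝ) - 1 := by linarith
    gcongr
    norm_num
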